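/- Let $\mathcal T$ be either the category $\mathbf{Top}$ of topological spaces and continuous maps (with free homotopies), or the category $\mathbf{Top^w}$ of well-pointed spaces (the inclusion of the base point is a closed cofibration) and base-point-preserving continuous maps (with pointed homotopies). Write $\simeq$ for homotopy in $\mathcal T$. A square $q\colon P\to X$, $p\colon P\to A$, $f\colon X\to Y$, $\iota\colon A\to Y$ in $\mathcal T$ is a homotopy pullback if there is a homotopy from $f\circ q$ to $\iota\circ p$ such that the induced map from $P$ to $\{(x,\omega,a)\in X\times Y^{[0,1]}\times A : \omega(0)=f(x),\ \omega(1)=\iota(a)\}$ is a homotopy equivalence (pointed in the case of $\mathbf{Top^w}$). Let $\mathrm{secat}$ be any assignment of a value $\mathrm{secat}(\iota)\in\mathbb N\cup\{\infty\}$ to each map $\iota\colon A\to Y$ in $\mathcal T$ such that (S0) $\mathrm{secat}(\iota)=0$ if and only if there is a map $s\colon Y\to A$ with $\iota\circ s\simeq \mathrm{id}_Y$; (S1) if $\iota\colon A\to X$, $\kappa\colon B\to X$, $\zeta\colon B\to A$ satisfy $\iota\circ\zeta\simeq\kappa$, then $\mathrm{secat}(\iota)\le\mathrm{secat}(\kappa)$;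 (S2) if $(q,p,f,\iota)$ is a homotopy pullback as above, then $\mathrm{secat}(q)\le\mathrm{secat}(\iota)$. For maps $f\colon X\to Y$ and $\iota\colon A\to Y$ in $\mathcal T$, the lifting category is $\mathrm{liftcat}_f(\iota)=\mathrm{secat}(q)$, where $(q,p,f,\iota)$ is any homotopy pullback of $f$ and $\iota$ in $\mathcal T$ (the value does not depend on the choice). Let $\kappa\colon B\to X$, $\zeta\colon B\to A$, $\iota\colon A\to Y$, $f\colon X\to Y$, $g\colon W\to X$, $h\colon W\to Y$ be maps in $\mathcal T$ with $f\circ\kappa\simeq\iota\circ\zeta$ and $h\simeq f\circ g$. Then $$\mathrm{liftcat}_h(\iota)\le\mathrm{liftcat}_g(\kappa).$$ If in addition the square $(\kappa,\zeta,f,\iota)$ is a homotopy pullback, then $\mathrm{liftcat}_h(\iota)=\mathrm{liftcat}_g(\kappa)$. In particular, if $f$ and $\zeta$ are homotopy equivalences in $\mathcal T$, then the square is a homotopy pullback and $\mathrm{liftcat}_h(\iota)=\mathrm{liftcat}_g(\kappa)$. Consequently, if $g,h\colon W\to Y$ and $\iota,\kappa\colon A\to Y$ are maps in $\mathcal T$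 with $h\simeq g$ and $\iota\simeq\kappa$, then $\mathrm{liftcat}_h(\iota)=\mathrm{liftcat}_g(\kappa)$. -/

import Mathlib

open scoped unitInterval

universe u

/-- The standard (double mapping path space) homotopy pullback of `f : X → Y` and `ι : A → Y`:
triples `(x, ω, a)` with `ω` a path in `Y` from `f x` to `ι a`, topologized as a subspace of
`X × Y^I × A`, where `Y^I` has the compact-open topology. -/
def StdHPullback {X A Y : Type u} [TopologicalSpace X] [TopologicalSpace A] [TopologicalSpace Y]
    (f : C(X, Y)) (ι : C(A, Y)) : Type u :=
  {z : X × C(I, Y) × A // z.2.1 0 = f z.1 ∧ z.2.1 1 = ι z.2.2}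

instance {X A Y : Type u} [TopologicalSpace X] [TopologicalSpace A] [TopologicalSpace Y]
    (f : C(X, Y)) (ι : C(A, Y)) : TopologicalSpace (StdHPullback f ι) :=
  instTopologicalSpaceSubtype

namespace StdHPullback

variable {X A Y P : Type u} [TopologicalSpace X] [TopologicalSpace A] [TopologicalSpace Y]
  [TopologicalSpace P]

/-- The projection to `X`. -/
def fst (f : C(X, Y)) (ι : C(A, Y)) : C(StdHPullback f ι, X) where
  toFun z := z.1.1
  continuous_toFun := continuous_fst.comp continuous_subtype_val

/-- The whisker map `b ↦ (q b, H(-, b), p b)` induced by a square `(q, p, f, ι)` together with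
a homotopy `H` from `f ∘ q` to `ι ∘ p`. -/
def whisker {f : C(X, Y)} {ι : C(A, Y)} {q : C(P, X)} {p : C(P, A)}
    (H : (f.comp q).Homotopy (ι.comp p)) : C(P, StdHPullback f ι) where
  toFun b := ⟨(q b, (H.toContinuousMap.comp ContinuousMap.prodSwap).curry b, p b),
    by simp [ContinuousMap.prodSwap]⟩
  continuous_toFun := by
    refine Continuous.subtype_mk ?_ _
    exact q.continuous.prodMk ((ContinuousMap.continuous _).prodMk p.continuous)

end StdHPullback

/-! ### The category `Top`: all topological spaces, continuous maps, free homotopies -/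

namespace FreeTop

/-- `f` is a homotopy equivalence. -/
def IsHEquiv {X Y : Type u} [TopologicalSpace X] [TopologicalSpace Y] (f : C(X, Y)) : Prop :=
  ∃ e : ContinuousMap.HomotopyEquiv X Y, e.toFun = f

/-- The square with `q : P → X`, `p : P → A`, `f : X → Y`, `ι : A → Y` is a homotopy pullback:
it commutes up to a homotopy whose whisker map to the standard homotopy pullback of `f` and `ι`
is a homotopy equivalence. -/
def IsHPullback {P X A Y : Type u} [TopologicalSpace P] [TopologicalSpace X]
    [TopologicalSpace A] [TopologicalSpace Y]
    (q : C(P, X)) (p : C(P, A)) (f : C(X, Y)) (ι : C(A, Y)) : Prop :=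
  ∃ H : (f.comp q).Homotopy (ι.comp p), IsHEquiv (StdHPullback.whisker H)

/-- An (abstract) sectional category on `Top`: an invariant of continuous maps, with values in
the natural numbers extended by `∞`, that satisfies the axioms `S0`, `S1`, `S2`. -/
structure SectionalCategory where
  /-- the invariant -/
  secat : ∀ {A Y : Type u} [TopologicalSpace A] [TopologicalSpace Y], C(A, Y) → ℕ∞
  S0 : ∀ {A Y : Type u} [TopologicalSpace A] [TopologicalSpace Y] (ι : C(A, Y)),
    secat ι = 0 ↔ ∃ s : C(Y, A), (ι.comp s).Homotopic (ContinuousMap.id Y)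
  S1 : ∀ {A B X : Type u} [TopologicalSpace A] [TopologicalSpace B] [TopologicalSpace X]
    (ι : C(A, X)) (κ : C(B, X)) (ζ : C(B, A)), (ι.comp ζ).Homotopic κ → secat ι ≤ secat κ
  S2 : ∀ {P X A Y : Type u} [TopologicalSpace P] [TopologicalSpace X] [TopologicalSpace A]
    [TopologicalSpace Y] (q : C(P, X)) (p : C(P, A)) (f : C(X, Y)) (ι : C(A, Y)),
    IsHPullback q p f ι → secat q ≤ secat ι

/-- The lifting category `liftcat_f(ι)`: the value `secat q` for a homotopy pullback
`(q, p, f, ι)` of `f` and `ι`. All homotopy pullbacks of `f` and `ι` give the same value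
(`liftcat_eq` below), so the set below has exactly one element. -/
noncomputable def SectionalCategory.liftcat (S : SectionalCategory.{u}) {X A Y : Type u}
    [TopologicalSpace X] [TopologicalSpace A] [TopologicalSpace Y]
    (f : C(X, Y)) (ι : C(A, Y)) : ℕ∞ :=
  sInf {n | ∃ (P : Type u) (_ : TopologicalSpace P) (q : C(P, X)) (p : C(P, A)),
    IsHPullback q p f ι ∧ n = S.secat q}

theorem IsHPullback.exists_whisker {P X A Y Z : Type u} [TopologicalSpace P]
    [TopologicalSpace X] [TopologicalSpace A] [TopologicalSpace Y] [TopologicalSpace Z]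
    {q : C(P, X)} {p : C(P, A)} {f : C(X, Y)} {ι : C(A, Y)} (h : IsHPullback q p f ι)
    (x : C(Z, X)) (a : C(Z, A)) (K : (f.comp x).Homotopic (ι.comp a)) :
    ∃ s : C(Z, P), (q.comp s).Homotopic x := by
  obtain ⟨H, e, he⟩ := h
  obtain ⟨K⟩ := K
  refine ⟨e.invFun.comp (StdHPullback.whisker K), ?_⟩
  have h1 := e.right_inv
  rw [he] at h1
  exact (ContinuousMap.Homotopic.refl (StdHPullback.fst f ι)).comp
    (h1.comp (ContinuousMap.Homotopic.refl (StdHPullback.whisker K)))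

theorem SectionalCategory.liftcat_eq (S : SectionalCategory.{u}) {P X A Y : Type u}
    [TopologicalSpace P] [TopologicalSpace X] [TopologicalSpace A] [TopologicalSpace Y]
    {q : C(P, X)} {p : C(P, A)} {f : C(X, Y)} {ι : C(A, Y)} (h : IsHPullback q p f ι) :
    S.liftcat f ι = S.secat q := by
  apply le_antisymm
  · exact sInf_le ⟨P, _, q, p, h, rfl⟩
  · refine le_sInf ?_
    rintro n ⟨P', _, q', p', h', rfl⟩
    obtain ⟨s, hs⟩ := h.exists_whisker q' p' ⟨h'.choose⟩
    exact S.S1 _ _ s hs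

end FreeTop

/-! ### The category `Top^w`: well-pointed spaces, pointed maps, pointed homotopies -/

/-- The map `i : A → X` is a closed cofibration: a closed embedding with the homotopy extension
property with respect to all spaces. -/
def IsClosedCofibration {A X : Type u} [TopologicalSpace A] [TopologicalSpace X]
    (i : C(A, X)) : Prop :=
  Topology.IsClosedEmbedding i ∧
    ∀ (Z : Type u) [TopologicalSpace Z] (g : C(X, Z)) (G : C(A × I, Z)),
      (∀ a, G (a, 0) = g (i a)) →
      ∃ F : C(X × I, Z), (∀ x, F (x, 0) = g x) ∧ ∀ a t, F (i a, t) = G (a, t)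

/-- A well-pointed space: the inclusion of the base point is a closed cofibration. -/
structure WPSpace where
  /-- the underlying space -/
  carrier : Type u
  /-- its topology -/
  [top : TopologicalSpace carrier]
  /-- the base point -/
  pt : carrier
  wellPointed : IsClosedCofibration (ContinuousMap.const PUnit.{u + 1} pt)

namespace WPSpace

instance : CoeSort WPSpace.{u} (Type u) := ⟨WPSpace.carrier⟩

instance (X : WPSpace.{u}) : TopologicalSpace X := X.top

/-- Continuous maps preserving base points. -/
structure Map (X Y : WPSpace.{u}) where
  /-- the underlying continuous map -/
  map : C(X, Y)
  map_pt : map X.pt = Y.pt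

/-- The identity. -/
def Map.id (X : WPSpace.{u}) : Map X X := ⟨ContinuousMap.id X, rfl⟩

/-- Composition `g ∘ f`. -/
def Map.comp {X Y Z : WPSpace.{u}} (g : Map Y Z) (f : Map X Y) : Map X Z :=
  ⟨g.map.comp f.map, by simp [f.map_pt, g.map_pt]⟩

/-- Pointed homotopy of pointed maps. -/
def Map.Homotopic {X Y : WPSpace.{u}} (f g : Map X Y) : Prop :=
  f.map.HomotopicRel g.map {X.pt}

/-- `f` is a pointed homotopy equivalence from `(X, x₀)` to `(Y, y₀)`. -/
def IsPointedHEquiv {X Y : Type u} [TopologicalSpace X] [TopologicalSpace Y] (x₀ : X) (y₀ : Y)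
    (f : C(X, Y)) : Prop :=
  f x₀ = y₀ ∧ ∃ g : C(Y, X), g y₀ = x₀ ∧
    (g.comp f).HomotopicRel (ContinuousMap.id X) {x₀} ∧
    (f.comp g).HomotopicRel (ContinuousMap.id Y) {y₀}

/-- A pointed map is a homotopy equivalence in `Top^w`. -/
def Map.IsHEquiv {X Y : WPSpace.{u}} (f : Map X Y) : Prop :=
  IsPointedHEquiv X.pt Y.pt f.map

/-- The base point of the standard homotopy pullback: the two base points and the constant
path. -/
def stdBase {X A Y : WPSpace.{u}} (f : Map X Y) (ι : Map A Y) : StdHPullback f.map ι.map :=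
  ⟨(X.pt, ContinuousMap.const I Y.pt, A.pt), by simp [f.map_pt, ι.map_pt]⟩

/-- The square with `q : P → X`, `p : P → A`, `f : X → Y`, `ι : A → Y` is a homotopy pullback in
`Top^w`: it commutes up to a pointed homotopy whose whisker map to the standard homotopy pullback
of `f` and `ι` is a pointed homotopy equivalence. -/
def IsHPullback {P X A Y : WPSpace.{u}} (q : Map P X) (p : Map P A) (f : Map X Y)
    (ι : Map A Y) : Prop :=
  ∃ H : (f.comp q).map.HomotopyRel (ι.comp p).map {P.pt},
    IsPointedHEquiv P.pt (stdBase f ι)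
      (StdHPullback.whisker (f := f.map) (ι := ι.map) (q := q.map) (p := p.map) H.toHomotopy)

/-- An (abstract) sectional category on `Top^w`: an invariant of pointed maps, with values in
the natural numbers extended by `∞`, that satisfies the axioms `S0`, `S1`, `S2`. -/
structure SectionalCategory where
  /-- the invariant -/
  secat : ∀ {A Y : WPSpace.{u}}, Map A Y → ℕ∞
  S0 : ∀ {A Y : WPSpace.{u}} (ι : Map A Y),
    secat ι = 0 ↔ ∃ s : Map Y A, (ι.comp s).Homotopic (Map.id Y)
  S1 : ∀ {A B X : WPSpace.{u}} (ι : Map A X) (κ : Map B X) (ζ : Map B A),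
    (ι.comp ζ).Homotopic κ → secat ι ≤ secat κ
  S2 : ∀ {P X A Y : WPSpace.{u}} (q : Map P X) (p : Map P A) (f : Map X Y) (ι : Map A Y),
    IsHPullback q p f ι → secat q ≤ secat ι

/-- The lifting category `liftcat_f(ι)`: the value `secat q` for a homotopy pullback
`(q, p, f, ι)` of `f` and `ι` in `Top^w`. All of these give the same value (`liftcat_eq` below),
so the set below has exactly one element (the standard homotopy pullback is well-pointed). -/
noncomputable def SectionalCategory.liftcat (S : SectionalCategory.{u}) {X A Y : WPSpace.{u}}
    (f : Map X Y) (ι : Map A Y) : ℕ∞ :=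
  sInf {n | ∃ (P : WPSpace.{u}) (q : Map P X) (p : Map P A),
    IsHPullback q p f ι ∧ n = S.secat q}

theorem IsHPullback.exists_whisker {P X A Y Z : WPSpace.{u}}
    {q : Map P X} {p : Map P A} {f : Map X Y} {ι : Map A Y} (h : IsHPullback q p f ι)
    (x : Map Z X) (a : Map Z A) (K : (f.comp x).Homotopic (ι.comp a)) :
    ∃ s : Map Z P, (q.comp s).Homotopic x := by
  obtain ⟨H, -, g, hg, -, ⟨G⟩⟩ := h
  obtain ⟨K⟩ := K
  let w : C(Z, StdHPullback f.map ι.map) :=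
    StdHPullback.whisker (q := x.map) (p := a.map) K.toHomotopy
  have hw : w Z.pt = stdBase f ι := by
    apply Subtype.ext
    refine Prod.ext x.map_pt (Prod.ext ?_ a.map_pt)
    ext t
    have := K.eq_fst t (Set.mem_singleton Z.pt)
    refine this.trans ?_
    change f.map (x.map Z.pt) = Y.pt
    rw [x.map_pt, f.map_pt]
  have hg' : (g.comp w) Z.pt = P.pt := by
    rw [ContinuousMap.comp_apply, hw, hg]
  refine ⟨⟨g.comp w, hg'⟩, ⟨⟨(ContinuousMap.Homotopy.refl
    (StdHPullback.fst f.map ι.map)).comp (G.toHomotopy.comp (ContinuousMap.Homotopy.refl w)),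
    ?_⟩⟩⟩
  rintro t z rfl
  have h1 := G.eq_fst t (x := w Z.pt) (Set.mem_singleton_iff.2 hw)
  exact congrArg (StdHPullback.fst f.map ι.map) h1

theorem SectionalCategory.liftcat_eq (S : SectionalCategory.{u}) {P X A Y : WPSpace.{u}}
    {q : Map P X} {p : Map P A} {f : Map X Y} {ι : Map A Y} (h : IsHPullback q p f ι) :
    S.liftcat f ι = S.secat q := by
  apply le_antisymm
  · exact sInf_le ⟨P, q, p, h, rfl⟩
  · refine le_sInf ?_
    rintro n ⟨P', q', p', h', rfl⟩
    obtain ⟨s, hs⟩ := h.exists_whisker q' p' ⟨h'.choose⟩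
    exact S.S1 _ _ s hs

end WPSpace

/-!
Free and pointed homotopies are both homotopies relative to a subset, the empty one or the base
point, so everything about homotopy pullbacks is proved for maps of pairs.

If `f` is a homotopy equivalence with inverse `g`, then so is the projection of the homotopy
pullback of `f` and `ι` to `A`: for `f = id` it has the section by constant paths, a homotopy of `f`
changes the homotopy pullback only by an equivalence, and the map of homotopy pullbacks induced by
`g` has an inverse on the right. Hence if moreover `p` is an equivalence, the whisker map of the
square `(q, p, f, ι)` is one by two out of three.

The standard homotopy pullback of well-pointed spaces is well-pointed. A closed cofibration is the
same as a neighbourhood deformation retract; deformations of the base points of `X` and `A` lift to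
a deformation into the fibre of `(fst, snd)`, and a deformation of the base point of `Y` deforms the
loops forming this fibre.

Finally, `liftcat f ι ≤ secat κ` as soon as `f ∘ κ` factors through `ι` up to homotopy, because `κ`
then factors through the homotopy pullback of `f` and `ι`. With `κ` replaced by the homotopy
pullback of `κ` along `g` this is the inequality; the converse for a homotopy pullback square
comes from its own universal property.
-/

section Drag

variable {Y : Type*}

/-- The path obtained from paths `δ`, `ω`, `ε` with `δ 0 = ω 0` and `ε 0 = ω 1` by running
backwards along `δ` from `δ t`, then along `ω`, then along `ε` up to `ε t`. The three paths are laid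
out side by side on `[-1, 2]`, and `s` runs through `[-t, 1 + t]`: for `t = 0` this is `ω` itself,
without any reparametrization. -/
noncomputable def drag (δ ω ε : I → Y) (t s : I) : Y :=
  if s * (1 + 2 * t) - t ≤ (0 : ℝ) then Set.IccExtend zero_le_one δ (t - s * (1 + 2 * t))
  else if (1 : ℝ) ≤ s * (1 + 2 * t) - t then
    Set.IccExtend zero_le_one ε (s * (1 + 2 * t) - t - 1)
  else Set.IccExtend zero_le_one ω (s * (1 + 2 * t) - t)

@[simp] theorem drag_source (δ ω ε : I → Y) (t : I) : drag δ ω ε t 0 = δ t := by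
  simp [drag, t.2.1]

@[simp] theorem drag_target (δ ω ε : I → Y) (t : I) : drag δ ω ε t 1 = ε t := by
  have ht : (0 : ℝ) ≤ t := t.2.1
  have hr : (1 : I) * (1 + 2 * t) - t = (1 + t : ℝ) := by
    rw [Set.Icc.coe_one]
    ring
  rw [drag, hr, if_neg (by linarith), if_pos (by linarith), add_sub_cancel_left, Set.IccExtend_val]

theorem drag_zero {δ ω ε : I → Y} (h₀ : δ 0 = ω 0) (h₁ : ε 0 = ω 1) (s : I) :
    drag δ ω ε 0 s = ω s := by
  simp only [drag, Set.Icc.coe_zero, mul_zero, add_zero, mul_one, sub_zero, zero_sub]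
  split_ifs with hs hs'
  · obtain rfl : s = 0 := le_antisymm hs s.2.1
    simpa using h₀
  · obtain rfl : s = 1 := le_antisymm s.2.2 hs'
    simpa using h₁
  · exact Set.IccExtend_val _ _ s

theorem drag_of_forall_eq {δ ω ε : I → Y} {c : Y} (hδ : ∀ r, δ r = c) (hω : ∀ r, ω r = c)
    (hε : ∀ r, ε r = c) (t s : I) : drag δ ω ε t s = c := by
  unfold drag Set.IccExtend
  split_ifs <;> simp only [Function.comp_apply, hδ, hω, hε]

@[fun_prop]
theorem continuous_drag {Z : Type*} [TopologicalSpace Z] [TopologicalSpace Y]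
    {δ ω ε : Z → I → Y} {t s : Z → I} (hδ : Continuous ↿δ) (hω : Continuous ↿ω)
    (hε : Continuous ↿ε) (ht : Continuous t) (hs : Continuous s)
    (h₀ : ∀ z, δ z 0 = ω z 0) (h₁ : ∀ z, ε z 0 = ω z 1) :
    Continuous fun z => drag (δ z) (ω z) (ε z) (t z) (s z) := by
  refine Continuous.if_le (hδ.IccExtend (by fun_prop)) (Continuous.if_le
    (hε.IccExtend (by fun_prop)) (hω.IccExtend (by fun_prop)) continuous_const (by fun_prop) ?_)
    (by fun_prop) continuous_const ?_
  · intro z hz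
    rw [← hz]
    simpa using h₁ z
  · intro z hz
    rw [← neg_sub, hz, if_neg (by norm_num)]
    simpa using h₀ z

end Drag

section RelHEquiv

variable {X Y Z : Type*} [TopologicalSpace X] [TopologicalSpace Y] [TopologicalSpace Z]
  {S : Set X} {T : Set Y} {U : Set Z}

/-- A map `f : X → Y` is a homotopy equivalence of the pairs `(X, S)` and `(Y, T)`, through
homotopies that are stationary on `S` and `T`. The case `S = T = ∅` is that of free homotopy
equivalences, the case of two points that of pointed ones. -/
def IsRelHEquiv (S : Set X) (T : Set Y) (f : C(X, Y)) : Prop :=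
  Set.MapsTo f S T ∧ ∃ g : C(Y, X), Set.MapsTo g T S ∧
    (g.comp f).HomotopicRel (ContinuousMap.id X) S ∧
    (f.comp g).HomotopicRel (ContinuousMap.id Y) T

theorem homotopicRel_precomp {f g : C(Y, Z)} (h : f.HomotopicRel g T) {k : C(X, Y)}
    (hk : Set.MapsTo k S T) : (f.comp k).HomotopicRel (g.comp k) S :=
  h.elim fun H => ⟨⟨H.toHomotopy.compContinuousMap k, fun t _ hx => H.eq_fst t (hk hx)⟩⟩

namespace IsRelHEquiv

theorem comp {g : C(Y, Z)} {f : C(X, Y)} (hg : IsRelHEquiv T U g) (hf : IsRelHEquiv S T f) :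
    IsRelHEquiv S U (g.comp f) := by
  obtain ⟨hgT, g', hg', hg₁, hg₂⟩ := hg
  obtain ⟨hfS, f', hf', hf₁, hf₂⟩ := hf
  exact ⟨hgT.comp hfS, f'.comp g', hf'.comp hg',
    ((homotopicRel_precomp hg₁ hfS).comp_continuousMap f').trans hf₁,
    ((homotopicRel_precomp hf₂ hg').comp_continuousMap g).trans hg₂⟩

theorem of_comp_left {g : C(Y, Z)} {f : C(X, Y)} (hg : IsRelHEquiv T U g)
    (hgf : IsRelHEquiv S U (g.comp f)) (hf : Set.MapsTo f S T) : IsRelHEquiv S T f := by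
  obtain ⟨hgT, g', -, hg₁, -⟩ := hg
  obtain ⟨-, k, hk, hk₁, hk₂⟩ := hgf
  have hfkg : (f.comp (k.comp g)).HomotopicRel (g'.comp g) T :=
    (homotopicRel_precomp hg₁ (k := f.comp (k.comp g)) (hf.comp (hk.comp hgT))).symm.trans
      ((homotopicRel_precomp hk₂ hgT).comp_continuousMap g')
  exact ⟨hf, k.comp g, hk.comp hgT, hk₁, hfkg.trans hg₁⟩

theorem of_comp_right {g : C(Y, Z)} {f : C(X, Y)} {f' : C(Y, X)}
    (hgf : IsRelHEquiv S U (g.comp f)) (hg : Set.MapsTo g T U) (hf : Set.MapsTo f S T)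
    (hf' : Set.MapsTo f' T S) (hff' : (f.comp f').HomotopicRel (ContinuousMap.id Y) T) :
    IsRelHEquiv T U g := by
  obtain ⟨-, k, hk, hk₁, hk₂⟩ := hgf
  have hfkg : (f.comp (k.comp g)).HomotopicRel (f.comp f') T :=
    (hff'.comp_continuousMap (f.comp (k.comp g))).symm.trans
      ((homotopicRel_precomp hk₁ hf').comp_continuousMap f)
  exact ⟨hg, f.comp k, hf.comp hk, hfkg.trans hff', hk₂⟩

end IsRelHEquiv

theorem FreeTop.isHEquiv_iff {X Y : Type u} [TopologicalSpace X] [TopologicalSpace Y]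
    {f : C(X, Y)} : FreeTop.IsHEquiv f ↔ IsRelHEquiv ∅ ∅ f := by
  simp only [IsRelHEquiv, Set.mapsTo_empty, ContinuousMap.homotopicRel_empty, true_and]
  exact ⟨fun ⟨e, he⟩ => he ▸ ⟨e.invFun, e.left_inv, e.right_inv⟩,
    fun ⟨g, hgf, hfg⟩ => ⟨⟨f, g, hgf, hfg⟩, rfl⟩⟩

theorem WPSpace.isPointedHEquiv_iff {X Y : Type u} [TopologicalSpace X] [TopologicalSpace Y]
    {x₀ : X} {y₀ : Y} {f : C(X, Y)} :
    WPSpace.IsPointedHEquiv x₀ y₀ f ↔ IsRelHEquiv {x₀} {y₀} f := by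
  simp only [WPSpace.IsPointedHEquiv, IsRelHEquiv, Set.mapsTo_singleton, Set.mem_singleton_iff]

end RelHEquiv

namespace StdHPullback

variable {X A Y Z : Type u} [TopologicalSpace X] [TopologicalSpace A] [TopologicalSpace Y]
  [TopologicalSpace Z]

section Components

variable {f : C(X, Y)} {ι : C(A, Y)}

/-- The projection to `A`. -/
def snd (f : C(X, Y)) (ι : C(A, Y)) : C(StdHPullback f ι, A) where
  toFun z := z.1.2.2
  continuous_toFun := (continuous_snd.comp continuous_snd).comp continuous_subtype_val

/-- The path component of a point of the standard homotopy pullback. -/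
def path (z : StdHPullback f ι) : C(I, Y) := z.1.2.1

@[fun_prop]
theorem continuous_path : Continuous (path : StdHPullback f ι → C(I, Y)) :=
  (continuous_fst.comp continuous_snd).comp continuous_subtype_val

@[simp] theorem path_zero (z : StdHPullback f ι) : z.path 0 = f (fst f ι z) := z.2.1

@[simp] theorem path_one (z : StdHPullback f ι) : z.path 1 = ι (snd f ι z) := z.2.2

protected theorem ext {z w : StdHPullback f ι} (h_fst : fst f ι z = fst f ι w)
    (h_path : ∀ s, z.path s = w.path s) (h_snd : snd f ι z = snd f ι w) : z = w :=
  Subtype.ext (Prod.ext h_fst (Prod.ext (ContinuousMap.ext h_path) h_snd))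

/-- The map into the standard homotopy pullback with prescribed components. -/
def lift (x : C(Z, X)) (ω : C(Z × I, Y)) (a : C(Z, A)) (h₀ : ∀ z, ω (z, 0) = f (x z))
    (h₁ : ∀ z, ω (z, 1) = ι (a z)) : C(Z, StdHPullback f ι) where
  toFun z := ⟨(x z, ω.curry z, a z), h₀ z, h₁ z⟩
  continuous_toFun := Continuous.subtype_mk
    (x.continuous.prodMk (ω.curry.continuous.prodMk a.continuous)) _

/-- The points of the standard homotopy pullback with a constant path and with ends in
prescribed subsets: the subset relative to which homotopies of maps into it are considered. -/
def base (f : C(X, Y)) (ι : C(A, Y)) (S : Set X) (T : Set A) : Set (StdHPullback f ι) :=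
  {z | fst f ι z ∈ S ∧ snd f ι z ∈ T ∧ ∀ s, z.path s = f (fst f ι z)}

theorem base_empty (f : C(X, Y)) (ι : C(A, Y)) : base f ι ∅ ∅ = ∅ :=
  Set.eq_empty_of_forall_notMem fun _ hz => hz.1

theorem mapsTo_snd_base (f : C(X, Y)) (ι : C(A, Y)) (S : Set X) (T : Set A) :
    Set.MapsTo (snd f ι) (base f ι S T) T := fun _ hz => hz.2.1

theorem map_snd_of_mem_base {S : Set X} {T : Set A} {z : StdHPullback f ι}
    (hz : z ∈ base f ι S T) : ι (snd f ι z) = f (fst f ι z) :=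
  z.path_one.symm.trans (hz.2.2 1)

end Components

section Slide

variable {f : C(X, Y)} {ι : C(A, Y)}

/-- The homotopy lifting property of `(fst, snd) : StdHPullback f ι → X × A`: a homotopy starting
at `z` over prescribed homotopies `x` and `a` of the two ends. -/
noncomputable def slide (z : C(Z, StdHPullback f ι)) (x : C(I × Z, X)) (a : C(I × Z, A))
    (hx : ∀ w, x (0, w) = fst f ι (z w)) (ha : ∀ w, a (0, w) = snd f ι (z w)) :
    C(I × Z, StdHPullback f ι) :=
  lift x
    ⟨fun p => drag (fun r => f (x (r, p.1.2))) (z p.1.2).path (fun r => ι (a (r, p.1.2))) p.1.1 p.2,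
      continuous_drag (by fun_prop) (by fun_prop) (by fun_prop) (by fun_prop) (by fun_prop)
        (by simp [hx]) (by simp [ha])⟩
    a (by simp) (by simp)

variable {z : C(Z, StdHPullback f ι)} {x : C(I × Z, X)} {a : C(I × Z, A)}
  {hx : ∀ w, x (0, w) = fst f ι (z w)} {ha : ∀ w, a (0, w) = snd f ι (z w)}

theorem slide_zero (w : Z) : slide z x a hx ha (0, w) = z w :=
  StdHPullback.ext (hx w) (fun s => drag_zero (by simp [hx]) (by simp [ha]) s) (ha w)

theorem slide_of_mem_base {S : Set X} {T : Set A} {w : Z} (hw : z w ∈ base f ι S T)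
    (hxw : ∀ t, x (t, w) = fst f ι (z w)) (haw : ∀ t, a (t, w) = snd f ι (z w)) (t : I) :
    slide z x a hx ha (t, w) = z w := by
  refine StdHPullback.ext (hxw t) (fun s => ?_) (haw t)
  rw [hw.2.2 s]
  exact drag_of_forall_eq (by simp [hxw]) hw.2.2 (by simp [haw, map_snd_of_mem_base hw]) t s

end Slide

section Transport

variable {f₀ f₁ : C(X, Y)}

/-- A homotopy `K` from `f₀` to `f₁` carries `(x, ω, a)` to `(x, ω', a)`, where `ω'` runs backwards
along `K (-, x)` and then along `ω`. -/
noncomputable def transport (K : f₀.Homotopy f₁) (ι : C(A, Y)) :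
    C(StdHPullback f₀ ι, StdHPullback f₁ ι) :=
  lift (fst _ _)
    ⟨fun p => drag (fun r => K (r, fst _ _ p.1)) p.1.path (fun _ => ι (snd _ _ p.1)) 1 p.2,
      continuous_drag (by fun_prop) (by fun_prop) (by fun_prop) (by fun_prop) (by fun_prop)
        (by simp) (by simp)⟩
    (snd _ _) (by simp) (by simp)

theorem mapsTo_transport {S : Set X} (K : f₀.HomotopyRel f₁ S) (ι : C(A, Y)) (T : Set A) :
    Set.MapsTo (transport K.toHomotopy ι) (base f₀ ι S T) (base f₁ ι S T) := by
  refine fun z hz => ⟨hz.1, hz.2.1, fun s => ?_⟩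
  have hf : f₁ (fst _ _ z) = f₀ (fst _ _ z) := (K.fst_eq_snd hz.1).symm
  exact (drag_of_forall_eq (fun r => K.eq_fst r hz.1) hz.2.2
    (fun _ => map_snd_of_mem_base hz) 1 s).trans hf.symm

theorem transport_symm_comp_transport {S : Set X} (K : f₀.HomotopyRel f₁ S) (ι : C(A, Y))
    (T : Set A) :
    ((transport K.symm.toHomotopy ι).comp (transport K.toHomotopy ι)).HomotopicRel
      (ContinuousMap.id _) (base f₀ ι S T) := by
  have hK₁ (r : I) (x : X) :
      K (Set.projIcc 0 1 zero_le_one ((1 : I) - r : ℝ), x) = K.symm (r, x) := by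
    rw [ContinuousMap.HomotopyRel.symm_apply, ← Set.projIcc_val zero_le_one (σ r)]
    rfl
  -- At time `t` the path runs along `K` from time `0` to time `t` and back again before `ω`.
  refine ContinuousMap.HomotopicRel.symm ⟨⟨⟨lift ((fst _ _).comp ContinuousMap.snd)
    ⟨fun p => drag (fun r => K (Set.projIcc 0 1 zero_le_one (p.1.1 - r : ℝ), fst _ _ p.1.2))
      (drag (fun r => K (r, fst _ _ p.1.2)) p.1.2.path (fun _ => ι (snd _ _ p.1.2)) p.1.1)
      (fun _ => ι (snd _ _ p.1.2)) p.1.1 p.2, ?_⟩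
    ((snd _ _).comp ContinuousMap.snd) ?_ ?_, fun z => ?_, fun z => ?_⟩, ?_⟩⟩
  · refine continuous_drag ?_ (continuous_drag ?_ ?_ ?_ ?_ ?_ ?_ ?_) ?_ ?_ ?_ ?_ ?_ <;>
      first | fun_prop | simp
  · simp
  · simp
  · refine StdHPullback.ext rfl (fun s => ?_) rfl
    exact (drag_zero (by simp) (by simp) s).trans (drag_zero (by simp) (by simp) s)
  · refine StdHPullback.ext rfl (fun s => ?_) rfl
    exact congrArg (fun δ => drag δ _ _ 1 s) (funext fun r => hK₁ r _)
  · intro t z hz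
    have hK (r : I) : K (r, fst _ _ z) = f₀ (fst _ _ z) := K.eq_fst r hz.1
    have hι : ι (snd _ _ z) = f₀ (fst _ _ z) := map_snd_of_mem_base hz
    refine StdHPullback.ext rfl (fun s => ?_) rfl
    exact (drag_of_forall_eq (fun _ => hK _)
      (drag_of_forall_eq hK hz.2.2 (fun _ => hι) t) (fun _ => hι) t s).trans (hz.2.2 s).symm

theorem isRelHEquiv_transport {S : Set X} (K : f₀.HomotopyRel f₁ S) (ι : C(A, Y)) (T : Set A) :
    IsRelHEquiv (base f₀ ι S T) (base f₁ ι S T) (transport K.toHomotopy ι) :=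
  ⟨mapsTo_transport K ι T, transport K.symm.toHomotopy ι, mapsTo_transport K.symm ι T,
    transport_symm_comp_transport K ι T,
    by simpa only [ContinuousMap.HomotopyRel.symm_symm] using!
      transport_symm_comp_transport K.symm ι T⟩

end Transport

end StdHPullback

namespace StdHPullback

variable {X A Y Z : Type u} [TopologicalSpace X] [TopologicalSpace A] [TopologicalSpace Y]
  [TopologicalSpace Z]

section BaseChange

variable {S : Set X} {T : Set A} {R : Set Y}

/-- The map of homotopy pullbacks induced by a map `u : Z → X`. -/
def pre (u : C(Z, X)) (f : C(X, Y)) (ι : C(A, Y)) :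
    C(StdHPullback (f.comp u) ι, StdHPullback f ι) :=
  lift (u.comp (fst _ _)) ⟨fun p => p.1.path p.2, by fun_prop⟩ (snd _ _) (by simp) (by simp)

theorem mapsTo_pre {u : C(Z, X)} {Q : Set Z} (hu : Set.MapsTo u Q S) (f : C(X, Y)) (ι : C(A, Y))
    (T : Set A) : Set.MapsTo (pre u f ι) (base (f.comp u) ι Q T) (base f ι S T) :=
  fun _ hz => ⟨hu hz.1, hz.2⟩

theorem pre_comp_transport {u : C(X, X)} (K : (ContinuousMap.id X).HomotopyRel u S) (f : C(X, Y))
    (ι : C(A, Y)) (T : Set A) :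
    ((pre u f ι).comp (transport ((K.compContinuousMap f).cast f.comp_id rfl).toHomotopy ι)
      ).HomotopicRel (ContinuousMap.id _) (base f ι S T) := by
  have hK (z : StdHPullback f ι) : K (0, fst f ι z) = fst f ι z := K.apply_zero _
  refine ContinuousMap.HomotopicRel.symm ⟨⟨⟨slide (ContinuousMap.id _)
    ⟨fun p => K (p.1, fst f ι p.2), by fun_prop⟩ ((snd f ι).comp ContinuousMap.snd) hK
    (fun _ => rfl), fun z => slide_zero z, fun z => ?_⟩, fun t _ hz => ?_⟩⟩
  · exact StdHPullback.ext (K.apply_one _) (fun _ => rfl) rfl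
  · exact slide_of_mem_base (hx := hK) (ha := fun _ => rfl) hz (fun t => K.eq_fst t hz.1)
      (fun _ => rfl) t

/-- The section `a ↦ (ι a, const, a)` of the projection from the homotopy pullback of the
identity. -/
def constSection (ι : C(A, Y)) : C(A, StdHPullback (ContinuousMap.id Y) ι) :=
  lift ι ⟨fun p => ι p.1, by fun_prop⟩ (ContinuousMap.id A) (fun _ => rfl) (fun _ => rfl)

theorem constSection_comp_snd (ι : C(A, Y)) (R : Set Y) (T : Set A) :
    ((constSection ι).comp (snd _ ι)).HomotopicRel (ContinuousMap.id _)
      (base (ContinuousMap.id Y) ι R T) := by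
  refine ContinuousMap.HomotopicRel.symm ⟨⟨⟨lift ⟨fun p => p.2.path p.1, by fun_prop⟩
    ⟨fun p => p.1.2.path (p.1.1 ⊔ p.2), by fun_prop⟩ ((snd _ _).comp ContinuousMap.snd)
    (by simp) (fun p => ?_), fun z => ?_, fun z => ?_⟩, fun t z hz => ?_⟩⟩
  · exact (congrArg p.2.path (max_eq_right p.1.2.2)).trans p.2.path_one
  · exact StdHPullback.ext z.path_zero (fun s => congrArg z.path (max_eq_right s.2.1)) rfl
  · refine StdHPullback.ext z.path_one (fun s => ?_) rfl
    exact (congrArg z.path (max_eq_left s.2.2)).trans z.path_one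
  · exact StdHPullback.ext (hz.2.2 t) (fun s => (hz.2.2 _).trans (hz.2.2 s).symm) rfl

theorem isRelHEquiv_snd_id {ι : C(A, Y)} (hι : Set.MapsTo ι T R) :
    IsRelHEquiv (base (ContinuousMap.id Y) ι R T) T (snd (ContinuousMap.id Y) ι) :=
  ⟨mapsTo_snd_base _ _ _ _, constSection ι, fun _ ha => ⟨hι ha, ha, fun _ => rfl⟩,
    constSection_comp_snd ι R T, .refl _⟩

theorem isRelHEquiv_snd {f : C(X, Y)} {ι : C(A, Y)} (hf : IsRelHEquiv S R f)
    (hι : Set.MapsTo ι T R) : IsRelHEquiv (base f ι S T) T (snd f ι) := by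
  obtain ⟨hfS, g, hg, hgf, ⟨L⟩⟩ := hf
  obtain ⟨K⟩ := hgf.symm
  have snd_fg : IsRelHEquiv (base (f.comp g) ι R T) T (snd (f.comp g) ι) :=
    (isRelHEquiv_snd_id hι).comp (isRelHEquiv_transport L ι T)
  let K' := (K.compContinuousMap f).cast f.comp_id rfl
  let w : C(StdHPullback f ι, StdHPullback (f.comp g) ι) :=
    (pre f (f.comp g) ι).comp (transport K'.toHomotopy ι)
  have hw : Set.MapsTo w (base f ι S T) (base (f.comp g) ι R T) :=
    (mapsTo_pre hfS (f.comp g) ι T).comp (mapsTo_transport K' ι T)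
  have pre_comp_w : ((pre g f ι).comp w).HomotopicRel (ContinuousMap.id _) (base f ι S T) :=
    pre_comp_transport K f ι T
  exact snd_fg.of_comp_right (g := snd f ι) (mapsTo_snd_base _ _ _ _) (mapsTo_pre hg f ι T) hw
    pre_comp_w

end BaseChange

end StdHPullback

section RelHPullback

variable {P X A Y : Type u} [TopologicalSpace P] [TopologicalSpace X] [TopologicalSpace A]
  [TopologicalSpace Y] {Q : Set P} {S : Set X} {T : Set A} {R : Set Y}
  {q : C(P, X)} {p : C(P, A)} {f : C(X, Y)} {ι : C(A, Y)}

open StdHPullback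

/-- The square `(q, p, f, ι)` is a homotopy pullback relative to the subsets `Q`, `S`, `T` of `P`,
`X`, `A`: it commutes up to a homotopy stationary on `Q`, whose whisker map is a relative homotopy
equivalence. Empty subsets give the notion for spaces, base points the one for pointed spaces. -/
def IsRelHPullback (Q : Set P) (S : Set X) (T : Set A) (q : C(P, X)) (p : C(P, A)) (f : C(X, Y))
    (ι : C(A, Y)) : Prop :=
  ∃ H : (f.comp q).HomotopyRel (ι.comp p) Q,
    IsRelHEquiv Q (base f ι S T) (whisker (f := f) (ι := ι) (q := q) (p := p) H.toHomotopy)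

theorem isRelHPullback_std (f : C(X, Y)) (ι : C(A, Y)) (S : Set X) (T : Set A) :
    IsRelHPullback (base f ι S T) S T (fst f ι) (snd f ι) f ι :=
  ⟨{ toFun := fun p => p.2.path p.1
     map_zero_left := path_zero
     map_one_left := path_one
     prop' := fun t _ hz => hz.2.2 t },
    Set.mapsTo_id _, ContinuousMap.id _, Set.mapsTo_id _, .refl _, .refl _⟩

theorem isRelHPullback_of_isRelHEquiv (h : (f.comp q).HomotopicRel (ι.comp p) Q)
    (hf : IsRelHEquiv S R f) (hp : IsRelHEquiv Q T p) (hq : Set.MapsTo q Q S)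
    (hι : Set.MapsTo ι T R) : IsRelHPullback Q S T q p f ι :=
  h.elim fun H => ⟨H, (isRelHEquiv_snd hf hι).of_comp_left hp
    fun _ hb => ⟨hq hb, hp.1 hb, fun s => H.eq_fst s hb⟩⟩

theorem FreeTop.isHPullback_iff :
    FreeTop.IsHPullback q p f ι ↔ IsRelHPullback ∅ ∅ ∅ q p f ι := by
  simp only [FreeTop.IsHPullback, IsRelHPullback, FreeTop.isHEquiv_iff, base_empty]
  exact ⟨fun ⟨H, h⟩ => ⟨⟨H, fun _ _ hx => hx.elim⟩, h⟩, fun ⟨H, h⟩ => ⟨H.toHomotopy, h⟩⟩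

end RelHPullback

namespace WPSpace

variable {P X A Y : WPSpace.{u}}

theorem base_singleton (f : Map X Y) (ι : Map A Y) :
    StdHPullback.base f.map ι.map {X.pt} {A.pt} = {stdBase f ι} := by
  refine Set.eq_singleton_iff_unique_mem.2
    ⟨⟨rfl, rfl, fun _ => f.map_pt.symm⟩, fun z ⟨hx, ha, hω⟩ => ?_⟩
  refine StdHPullback.ext hx (fun s => ?_) ha
  rw [hω s, Set.mem_singleton_iff.1 hx]
  exact f.map_pt

theorem isHPullback_iff {q : Map P X} {p : Map P A} {f : Map X Y} {ι : Map A Y} :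
    IsHPullback q p f ι ↔
      IsRelHPullback {P.pt} {X.pt} {A.pt} q.map p.map f.map ι.map := by
  simp only [IsHPullback, IsRelHPullback, isPointedHEquiv_iff, base_singleton]
  rfl

end WPSpace

section Cofibration

variable {X A B : Type u} [TopologicalSpace X] [TopologicalSpace A] [TopologicalSpace B]

theorem IsClosedCofibration.comp {j : C(A, X)} {i : C(B, A)} (hj : IsClosedCofibration j)
    (hi : IsClosedCofibration i) : IsClosedCofibration (j.comp i) := by
  refine ⟨hj.1.comp hi.1, fun Z _ g G hG => ?_⟩
  obtain ⟨F, hF₀, hF⟩ := hi.2 Z (g.comp j) G hG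
  obtain ⟨F', hF'₀, hF'⟩ := hj.2 Z g F hF₀
  exact ⟨F', hF'₀, fun b t => (hF' (i b) t).trans (hF b t)⟩

theorem isClosedCofibration_iff_exists_retraction {i : C(A, X)} :
    IsClosedCofibration i ↔ Topology.IsClosedEmbedding i ∧
      ∃ r : C(X × I, X × I), (∀ p, (r p).1 ∈ Set.range i ∨ (r p).2 = 0) ∧
        (∀ x, r (x, 0) = (x, 0)) ∧ ∀ a t, r (i a, t) = (i a, t) := by
  refine and_congr_right fun hi => ⟨fun hep => ?_, fun ⟨r, hr, hr₀, hrA⟩ Z _ g G hG => ?_⟩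
  · obtain ⟨F, hF₀, hF⟩ := hep {p : X × I // p.1 ∈ Set.range i ∨ p.2 = 0}
      ⟨fun x => ⟨(x, 0), .inr rfl⟩, by fun_prop⟩
      ⟨fun p => ⟨(i p.1, p.2), .inl ⟨p.1, rfl⟩⟩, by fun_prop⟩ fun _ => rfl
    exact ⟨⟨fun p => F p, by fun_prop⟩, fun p => (F p).2, fun x => congrArg Subtype.val (hF₀ x),
      fun a t => congrArg Subtype.val (hF a t)⟩
  · let i' : A × I → X × I := Prod.map i id
    have hi' : Topology.IsClosedEmbedding i' := hi.prodMap .id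
    let k : X × I → Z := Function.extend i' G (g ∘ Prod.fst)
    have k_apply (a : A) (t : I) : k (i a, t) = G (a, t) :=
      hi'.injective.extend_apply G (g ∘ Prod.fst) (a, t)
    have k_zero (x : X) : k (x, 0) = g x := by
      by_cases hx : ∃ p, i' p = (x, 0)
      · obtain ⟨⟨a, t⟩, hp⟩ := hx
        obtain ⟨rfl, rfl⟩ : i a = x ∧ t = 0 := Prod.ext_iff.1 hp
        exact (k_apply a 0).trans (hG a)
      · exact Function.extend_apply' _ _ _ hx
    have hk : ContinuousOn k (Set.range i' ∪ {p | p.2 = 0}) := by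
      refine ContinuousOn.union_of_isClosed ?_ ?_ hi'.isClosed_range
        (isClosed_singleton.preimage continuous_snd)
      · rw [← Set.image_univ, hi'.isInducing.continuousOn_image_iff,
          Function.extend_comp hi'.injective]
        exact G.continuous.continuousOn
      · exact (g.continuous.comp continuous_fst).continuousOn.congr
          fun p (hp : p.2 = 0) => (congrArg (fun t => k (p.1, t)) hp).trans (k_zero p.1)
    refine ⟨⟨k ∘ r, hk.comp_continuous r.continuous fun p => (hr p).imp_left ?_⟩,
      fun x => (congrArg k (hr₀ x)).trans (k_zero x),
      fun a t => (congrArg k (hrA a t)).trans (k_apply a t)⟩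
    exact fun ⟨a, ha⟩ => ⟨(a, (r p).2), Prod.ext ha rfl⟩

/-- The subset `A` of `X` is a neighbourhood deformation retract: `u` vanishes on `A`, and `h` is a
homotopy of the identity, stationary on `A`, that has moved every point `x` with `u x ≤ 1` into `A`
by the time `u x`. -/
structure NDR (A : Set X) where
  /-- the function measuring the distance to the subset -/
  u : C(X, ℝ)
  /-- the deformation -/
  h : C(I × X, X)
  u_nonneg : ∀ x, 0 ≤ u x
  u_of_mem : ∀ x ∈ A, u x = 0
  h_zero : ∀ x, h (0, x) = x
  h_of_mem : ∀ t, ∀ x ∈ A, h (t, x) = x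
  h_mem : ∀ (t : I) (x : X), u x ≤ t → h (t, x) ∈ A

/-- The deformation that follows `φ` for the time `u x` and then stays put. -/
noncomputable def NDR.truncate {A : Set X} (u : C(X, ℝ)) (φ : C(I × X, X)) (u_nonneg : ∀ x, 0 ≤ u x)
    (u_of_mem : ∀ x ∈ A, u x = 0) (φ_zero : ∀ x, φ (0, x) = x)
    (φ_mem : ∀ (t : I) (x : X), u x = t → φ (t, x) ∈ A) : NDR A where
  u := u
  h := ⟨fun p => φ (p.1 ⊓ Set.projIcc 0 1 zero_le_one (u p.2), p.2), by fun_prop⟩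
  u_nonneg := u_nonneg
  u_of_mem := u_of_mem
  h_zero x := (congrArg (fun t => φ (t, x)) (min_eq_left bot_le)).trans (φ_zero x)
  h_of_mem t x hx := by simp [u_of_mem x hx, φ_zero]
  h_mem t x hxt := by
    have hux : t ⊓ Set.projIcc 0 1 zero_le_one (u x) = ⟨u x, u_nonneg x, hxt.trans t.2.2⟩ :=
      (congrArg (t ⊓ ·) (Set.projIcc_of_mem zero_le_one _)).trans (min_eq_right hxt)
    exact (congrArg (fun s => φ (s, x) ∈ A) hux).mpr (φ_mem _ x rfl)

theorem NDR.isClosed {A : Set X} (N : NDR A) : IsClosed A := by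
  have hA : A = N.u ⁻¹' {0} := Set.Subset.antisymm N.u_of_mem fun x (hx : N.u x = 0) =>
    N.h_zero x ▸ N.h_mem 0 x hx.le
  exact hA ▸ isClosed_singleton.preimage N.u.continuous

theorem NDR.isClosedCofibration {S : Set X} (N : NDR S) {i : C(A, X)}
    (hi : Topology.IsEmbedding i) (hS : Set.range i = S) : IsClosedCofibration i := by
  subst hS
  refine isClosedCofibration_iff_exists_retraction.2 ⟨⟨hi, N.isClosed⟩,
    ⟨fun p => (N.h p.swap, Set.projIcc 0 1 zero_le_one (p.2 - N.u p.1)), by fun_prop⟩,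
    fun p => ?_, fun x => ?_, fun a t => ?_⟩
  · exact (le_total (N.u p.1) p.2).imp (N.h_mem p.2 p.1) fun hp =>
      Set.projIcc_of_le_left zero_le_one (sub_nonpos.2 hp)
  · exact Prod.ext (N.h_zero x) (Set.projIcc_of_le_left zero_le_one (by simp [N.u_nonneg x]))
  · refine Prod.ext (N.h_of_mem t _ ⟨a, rfl⟩) ?_
    simp [N.u_of_mem (i a) ⟨a, rfl⟩]

theorem IsClosedCofibration.nonempty_ndr {i : C(A, X)} (hi : IsClosedCofibration i) :
    Nonempty (NDR (Set.range i)) := by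
  obtain ⟨hi, r, hr, hr₀, hrA⟩ := isClosedCofibration_iff_exists_retraction.1 hi
  let d : C(X × I, ℝ) := ⟨fun p => p.2 - (r p).2, by fun_prop⟩
  have mem_of_lt (x : X) (t : I) (ht : ‖d.curry x‖ < t) : (r (x, t)).1 ∈ Set.range i := by
    refine (hr (x, t)).resolve_right fun h₀ => ht.not_ge ?_
    have hd : d.curry x t = t := by simp [d, h₀]
    exact hd ▸ (le_abs_self _).trans ((d.curry x).norm_coe_le_norm t)
  have mem_of_eq_zero (x : X) (t : I) (hx : ‖d.curry x‖ = 0) : (r (x, t)).1 ∈ Set.range i := by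
    have hclosed : IsClosed {s | (r (x, s)).1 ∈ Set.range i} :=
      hi.isClosed_range.preimage (by fun_prop)
    have hpos : Set.Ioi 0 ⊆ {s | (r (x, s)).1 ∈ Set.range i} := fun s hs =>
      mem_of_lt x s (hx.trans_lt hs)
    have ht : t ∈ closure (Set.Ioi 0) := by
      rw [closure_Ioi' ⟨1, one_pos⟩]
      exact t.2.1
    exact hclosed.closure_subset_iff.2 hpos ht
  -- The factor `2` makes `u x ≤ t` imply `‖d.curry x‖ < t` where `d.curry x` is nonzero.
  refine ⟨⟨⟨fun x => 2 * ‖d.curry x‖, by fun_prop⟩, ⟨fun p => (r p.swap).1, by fun_prop⟩,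
    fun x => mul_nonneg zero_le_two (norm_nonneg _), ?_, fun x => congrArg Prod.fst (hr₀ x), ?_,
    fun t x hx => ?_⟩⟩
  · rintro _ ⟨a, rfl⟩
    have hd : d.curry (i a) = 0 := ContinuousMap.ext fun t => by simp [d, hrA]
    simp [hd]
  · rintro t _ ⟨a, rfl⟩
    exact congrArg Prod.fst (hrA a t)
  · rcases (norm_nonneg (d.curry x)).eq_or_lt with h₀ | hpos
    · exact mem_of_eq_zero x t h₀.symm
    · exact mem_of_lt x t (by simp only [ContinuousMap.coe_mk] at hx; linarith)

end Cofibration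

namespace StdHPullback

variable {X A Y : Type u} [TopologicalSpace X] [TopologicalSpace A] [TopologicalSpace Y]
  {S : Set X} {T : Set A} {R : Set Y}

/-- The part of the standard homotopy pullback with ends in prescribed subsets. -/
def endsIn (f : C(X, Y)) (ι : C(A, Y)) (S : Set X) (T : Set A) : Set (StdHPullback f ι) :=
  {z | fst f ι z ∈ S ∧ snd f ι z ∈ T}

/-- The deformation of `endsIn f ι S T` obtained from deformations of `S` and `T` by lifting them
along `(fst, snd)`. The lifted homotopy need not be stationary on `endsIn f ι S T`. -/
noncomputable def ndrEndsIn (f : C(X, Y)) (ι : C(A, Y)) (NX : NDR S) (NA : NDR T) :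
    NDR (endsIn f ι S T) :=
  NDR.truncate ⟨fun z => NX.u (fst f ι z) ⊔ NA.u (snd f ι z), by fun_prop⟩
    (slide (ContinuousMap.id _) (NX.h.comp ((ContinuousMap.id I).prodMap (fst f ι)))
      (NA.h.comp ((ContinuousMap.id I).prodMap (snd f ι))) (fun _ => NX.h_zero _)
      (fun _ => NA.h_zero _))
    (fun _ => le_sup_of_le_left (NX.u_nonneg _))
    (fun z hz => by simp [NX.u_of_mem _ hz.1, NA.u_of_mem _ hz.2])
    (fun z => slide_zero z)
    (fun t z hz => ⟨NX.h_mem t _ (hz ▸ le_sup_left), NA.h_mem t _ (hz ▸ le_sup_right)⟩)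

/-- The deformation of the paths of `endsIn f ι S T` into `R`, which fixes their ends because these
lie in `R`. -/
noncomputable def ndrPathsIn {f : C(X, Y)} {ι : C(A, Y)} (hf : Set.MapsTo f S R)
    (hι : Set.MapsTo ι T R) (N : NDR R) : NDR {z : endsIn f ι S T | ∀ s, z.1.path s ∈ R} where
  u := ⟨fun z => ‖N.u.comp z.1.path‖, by fun_prop⟩
  h := ⟨fun p => ⟨lift (Z := I × endsIn f ι S T) ⟨fun p => fst f ι p.2, by fun_prop⟩
    ⟨fun p => N.h (p.1.1, p.1.2.1.path p.2), by fun_prop⟩ ⟨fun p => snd f ι p.2, by fun_prop⟩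
    (fun p => by simp [N.h_of_mem _ _ (hf p.2.2.1)])
    (fun p => by simp [N.h_of_mem _ _ (hι p.2.2.2)])
    p, p.2.2⟩, by fun_prop⟩
  u_nonneg z := norm_nonneg (N.u.comp z.1.path)
  u_of_mem z hz := by
    have : N.u.comp z.1.path = 0 := ContinuousMap.ext fun s => N.u_of_mem _ (hz s)
    exact (congrArg norm this).trans norm_zero
  h_zero z := Subtype.ext (StdHPullback.ext rfl (fun _ => N.h_zero _) rfl)
  h_of_mem t z hz := Subtype.ext (StdHPullback.ext rfl (fun s => N.h_of_mem t _ (hz s)) rfl)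
  h_mem t z hz s := N.h_mem t _ <|
    (le_abs_self _).trans (((N.u.comp z.1.path).norm_coe_le_norm s).trans hz)

end StdHPullback

namespace WPSpace

variable {X A Y : WPSpace.{u}}

theorem nonempty_ndr_pt (X : WPSpace.{u}) : Nonempty (NDR {X.pt}) :=
  (Set.range_const (ι := PUnit.{u + 1}) (c := X.pt)) ▸ X.wellPointed.nonempty_ndr

theorem isClosedCofibration_stdBase (f : Map X Y) (ι : Map A Y) :
    IsClosedCofibration (ContinuousMap.const PUnit.{u + 1} (stdBase f ι)) := by
  obtain ⟨NX⟩ := X.nonempty_ndr_pt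
  obtain ⟨NA⟩ := A.nonempty_ndr_pt
  obtain ⟨NY⟩ := Y.nonempty_ndr_pt
  let F := StdHPullback.endsIn f.map ι.map {X.pt} {A.pt}
  let j : C(F, StdHPullback f.map ι.map) := ⟨Subtype.val, continuous_subtype_val⟩
  let i : C(PUnit.{u + 1}, F) := ContinuousMap.const _ ⟨stdBase f ι, rfl, rfl⟩
  have range_i : Set.range i = {z : F | ∀ s, z.1.path s ∈ ({Y.pt} : Set Y)} := by
    refine Set.range_const.trans (Set.eq_singleton_iff_unique_mem.2 ⟨?_, fun z hz => ?_⟩).symm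
    · exact fun _ => rfl
    · exact Subtype.ext (StdHPullback.ext z.2.1 hz z.2.2)
  have hj : IsClosedCofibration j :=
    (StdHPullback.ndrEndsIn f.map ι.map NX NA).isClosedCofibration .subtypeVal Subtype.range_val
  have hi : IsClosedCofibration i :=
    (StdHPullback.ndrPathsIn (by simpa using f.map_pt) (by simpa using ι.map_pt)
      NY).isClosedCofibration (.of_subsingleton _) range_i
  exact hj.comp hi

/-- The standard homotopy pullback as a well-pointed space. -/
def std (f : Map X Y) (ι : Map A Y) : WPSpace.{u} where
  carrier := StdHPullback f.map ι.map
  pt := stdBase f ι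
  wellPointed := isClosedCofibration_stdBase f ι

end WPSpace

namespace FreeTop

open StdHPullback

variable {A B W X Y : Type u} [TopologicalSpace A] [TopologicalSpace B] [TopologicalSpace W]
  [TopologicalSpace X] [TopologicalSpace Y]

theorem isHPullback_std (f : C(X, Y)) (ι : C(A, Y)) : IsHPullback (fst f ι) (snd f ι) f ι :=
  isHPullback_iff.2 (base_empty f ι ▸ isRelHPullback_std f ι ∅ ∅)

theorem isHPullback_of_isHEquiv {κ : C(B, X)} {ζ : C(B, A)} {f : C(X, Y)} {ι : C(A, Y)}
    (h : (f.comp κ).Homotopic (ι.comp ζ)) (hf : IsHEquiv f) (hζ : IsHEquiv ζ) :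
    IsHPullback κ ζ f ι :=
  isHPullback_iff.2 <| isRelHPullback_of_isRelHEquiv (ContinuousMap.homotopicRel_empty.2 h)
    (isHEquiv_iff.1 hf) (isHEquiv_iff.1 hζ) (Set.mapsTo_empty _ _) (Set.mapsTo_empty _ _)

theorem IsHPullback.homotopic {κ : C(B, X)} {ζ : C(B, A)} {f : C(X, Y)} {ι : C(A, Y)}
    (h : IsHPullback κ ζ f ι) : (f.comp κ).Homotopic (ι.comp ζ) :=
  ⟨h.choose⟩

namespace SectionalCategory

variable (S : SectionalCategory.{u}) {κ : C(B, X)} {ζ : C(B, A)} {f : C(X, Y)} {ι : C(A, Y)}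
  {g : C(W, X)} {h : C(W, Y)}

theorem liftcat_le_secat (hs : (f.comp κ).Homotopic (ι.comp ζ)) : S.liftcat f ι ≤ S.secat κ := by
  obtain ⟨s, hs'⟩ := (isHPullback_std f ι).exists_whisker κ ζ hs
  exact (S.liftcat_eq (isHPullback_std f ι)).trans_le (S.S1 _ _ s hs')

theorem liftcat_le (hs : (f.comp κ).Homotopic (ι.comp ζ)) (hh : (f.comp g).Homotopic h) :
    S.liftcat h ι ≤ S.liftcat g κ := by
  have hP := isHPullback_std g κ
  rw [S.liftcat_eq hP]
  exact S.liftcat_le_secat (ζ := ζ.comp (snd g κ)) <| (hh.symm.comp (.refl _)).trans <|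
    ((ContinuousMap.Homotopic.refl f).comp hP.homotopic).trans (hs.comp (.refl _))

theorem liftcat_eq_of_isHPullback (hs : IsHPullback κ ζ f ι) (hh : (f.comp g).Homotopic h) :
    S.liftcat h ι = S.liftcat g κ := by
  refine le_antisymm (S.liftcat_le hs.homotopic hh) ?_
  have hP := isHPullback_std h ι
  obtain ⟨b, hb⟩ := hs.exists_whisker (g.comp (fst h ι)) (snd h ι)
    ((hh.comp (.refl (fst h ι))).trans hP.homotopic)
  exact (S.liftcat_le_secat hb.symm).trans_eq (S.liftcat_eq hP).symm

end SectionalCategory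

end FreeTop

namespace WPSpace

variable {A B W X Y : WPSpace.{u}}

theorem isHPullback_std (f : Map X Y) (ι : Map A Y) :
    IsHPullback (P := std f ι) ⟨StdHPullback.fst f.map ι.map, rfl⟩
      ⟨StdHPullback.snd f.map ι.map, rfl⟩ f ι :=
  isHPullback_iff.2 (base_singleton f ι ▸ isRelHPullback_std f.map ι.map {X.pt} {A.pt})

theorem isHPullback_of_isHEquiv {κ : Map B X} {ζ : Map B A} {f : Map X Y} {ι : Map A Y}
    (h : (f.comp κ).Homotopic (ι.comp ζ)) (hf : f.IsHEquiv) (hζ : ζ.IsHEquiv) :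
    IsHPullback κ ζ f ι :=
  isHPullback_iff.2 <| isRelHPullback_of_isRelHEquiv h (isPointedHEquiv_iff.1 hf)
    (isPointedHEquiv_iff.1 hζ) (by simpa using κ.map_pt) (by simpa using ι.map_pt)

theorem Map.Homotopic.postcomp {f g : Map X Y} (h : f.Homotopic g) (k : Map Y W) :
    (k.comp f).Homotopic (k.comp g) :=
  ContinuousMap.HomotopicRel.comp_continuousMap h k.map

theorem Map.Homotopic.precomp {f g : Map X Y} (h : f.Homotopic g) (k : Map W X) :
    (f.comp k).Homotopic (g.comp k) :=
  homotopicRel_precomp h (by simpa using k.map_pt)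

theorem IsHPullback.homotopic {κ : Map B X} {ζ : Map B A} {f : Map X Y} {ι : Map A Y}
    (h : IsHPullback κ ζ f ι) : (f.comp κ).Homotopic (ι.comp ζ) :=
  ⟨h.choose⟩

namespace SectionalCategory

variable (S : SectionalCategory.{u}) {κ : Map B X} {ζ : Map B A} {f : Map X Y} {ι : Map A Y}
  {g : Map W X} {h : Map W Y}

theorem liftcat_le_secat (hs : (f.comp κ).Homotopic (ι.comp ζ)) : S.liftcat f ι ≤ S.secat κ := by
  obtain ⟨s, hs'⟩ := (isHPullback_std f ι).exists_whisker κ ζ hs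
  exact (S.liftcat_eq (isHPullback_std f ι)).trans_le (S.S1 _ _ s hs')

theorem liftcat_le (hs : (f.comp κ).Homotopic (ι.comp ζ)) (hh : (f.comp g).Homotopic h) :
    S.liftcat h ι ≤ S.liftcat g κ := by
  have hP := isHPullback_std g κ
  rw [S.liftcat_eq hP]
  exact S.liftcat_le_secat (ζ := ζ.comp _) <|
    (Map.Homotopic.precomp (ContinuousMap.HomotopicRel.symm hh) _).trans <|
      (hP.homotopic.postcomp f).trans (hs.precomp _)

theorem liftcat_eq_of_isHPullback (hs : IsHPullback κ ζ f ι) (hh : (f.comp g).Homotopic h) :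
    S.liftcat h ι = S.liftcat g κ := by
  refine le_antisymm (S.liftcat_le hs.homotopic hh) ?_
  have hP := isHPullback_std h ι
  obtain ⟨b, hb⟩ := hs.exists_whisker (g.comp _) _ ((hh.precomp _).trans hP.homotopic)
  exact (S.liftcat_le_secat (ContinuousMap.HomotopicRel.symm hb)).trans_eq (S.liftcat_eq hP).symm

end SectionalCategory

end WPSpace

theorem mainTheorem6 :
    -- the category `Top`
    (∀ S : FreeTop.SectionalCategory.{u},
      (∀ (A B W X Y : Type u) [TopologicalSpace A] [TopologicalSpace B] [TopologicalSpace W]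
        [TopologicalSpace X] [TopologicalSpace Y]
        (κ : C(B, X)) (ζ : C(B, A)) (ι : C(A, Y)) (f : C(X, Y)) (g : C(W, X)) (h : C(W, Y)),
        (f.comp κ).Homotopic (ι.comp ζ) → (f.comp g).Homotopic h →
          S.liftcat h ι ≤ S.liftcat g κ ∧
          (FreeTop.IsHPullback κ ζ f ι → S.liftcat h ι = S.liftcat g κ) ∧
          (FreeTop.IsHEquiv f → FreeTop.IsHEquiv ζ →
            FreeTop.IsHPullback κ ζ f ι ∧ S.liftcat h ι = S.liftcat g κ)) ∧
      (∀ (A W Y : Type u) [TopologicalSpace A] [TopologicalSpace W] [TopologicalSpace Y]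
        (g h : C(W, Y)) (ι κ : C(A, Y)), h.Homotopic g → ι.Homotopic κ →
          S.liftcat h ι = S.liftcat g κ)) ∧
    -- the category `Top^w`
    (∀ S : WPSpace.SectionalCategory.{u},
      (∀ (A B W X Y : WPSpace.{u})
        (κ : B.Map X) (ζ : B.Map A) (ι : A.Map Y) (f : X.Map Y) (g : W.Map X) (h : W.Map Y),
        (f.comp κ).Homotopic (ι.comp ζ) → (f.comp g).Homotopic h →
          S.liftcat h ι ≤ S.liftcat g κ ∧
          (WPSpace.IsHPullback κ ζ f ι → S.liftcat h ι = S.liftcat g κ) ∧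
          (f.IsHEquiv → ζ.IsHEquiv →
            WPSpace.IsHPullback κ ζ f ι ∧ S.liftcat h ι = S.liftcat g κ)) ∧
      (∀ (A W Y : WPSpace.{u}) (g h : W.Map Y) (ι κ : A.Map Y), h.Homotopic g → ι.Homotopic κ →
          S.liftcat h ι = S.liftcat g κ)) := by
  refine ⟨fun S => ⟨?_, ?_⟩, fun S => ⟨?_, ?_⟩⟩
  · intro A B W X Y _ _ _ _ _ κ ζ ι f g h hs hh
    refine ⟨S.liftcat_le hs hh, fun hP => S.liftcat_eq_of_isHPullback hP hh, fun hf hζ => ?_⟩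
    have hP := FreeTop.isHPullback_of_isHEquiv hs hf hζ
    exact ⟨hP, S.liftcat_eq_of_isHPullback hP hh⟩
  · intro A W Y _ _ _ g h ι κ hgh hικ
    exact le_antisymm
      (S.liftcat_le (f := ContinuousMap.id Y) (ζ := ContinuousMap.id A) hικ.symm hgh.symm)
      (S.liftcat_le (f := ContinuousMap.id Y) (ζ := ContinuousMap.id A) hικ hgh)
  · intro A B W X Y κ ζ ι f g h hs hh
    refine ⟨S.liftcat_le hs hh, fun hP => S.liftcat_eq_of_isHPullback hP hh, fun hf hζ => ?_⟩
    have hP := WPSpace.isHPullback_of_isHEquiv hs hf hζ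
    exact ⟨hP, S.liftcat_eq_of_isHPullback hP hh⟩
  · intro A W Y g h ι κ hgh hικ
    exact le_antisymm
      (S.liftcat_le (f := WPSpace.Map.id Y) (ζ := WPSpace.Map.id A) hικ.symm hgh.symm)
      (S.liftcat_le (f := WPSpace.Map.id Y) (ζ := WPSpace.Map.id A) hικ hgh)
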